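/- There is an absolute constant $C>0$ such that the following holds. Let $d,k,\ell$ be positive integers with $\ell\le d$, let $\epsilon>0$ be real with $k\ge C\,(d+1/\epsilon^2)$, and let $D\in\mathbb{R}^{d\times d}$ be symmetric (not necessarily positive semidefinite) with Frobenius norm $\|D\|_F\le 1$. For a real symmetric matrix $A$ let $\lambda_\ell(A)$ denote its $\ell$-th largest eigenvalue, counted with multiplicity, and suppose $\lambda_\ell(D)\ge 0$. Let $G\in\mathbb{R}^{k\times d}$ be a random matrix with i.i.d. $\mathcal{N}(0,1/k)$ entries. Then $\ell\le k$, and with probability at least $1-\frac{1}{20}2^{-\ell}$, \[ \lambda_\ell(GDG^T)\ \ge\ \lambda_\ell(D)-\epsilon . \] -/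

import Mathlib

open MeasureTheory ProbabilityTheory
open scoped NNReal Matrix Matrix.Norms.Frobenius

/-- The `ℓ`-th largest eigenvalue `λ_ℓ(A)` (`1 ≤ ℓ ≤ n`, counted with multiplicity) of a real
symmetric `n × n` matrix `A`. Mathlib's `eigenvalues₀` lists the eigenvalues in non-increasing
order, indexed from `0`. -/
noncomputable def sortedEigenvalue {n : ℕ} {A : Matrix (Fin n) (Fin n) ℝ} (hA : A.IsHermitian)
    (ℓ : ℕ) (h1 : 1 ≤ ℓ) (hn : ℓ ≤ n) : ℝ :=
  hA.eigenvalues₀ ⟨ℓ - 1, by rw [Fintype.card_fin]; omega⟩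

/-- For a symmetric `D`, the sketch `G D Gᵀ` is symmetric. -/
theorem isHermitian_sketch {k d : ℕ} (G : Matrix (Fin k) (Fin d) ℝ)
    {D : Matrix (Fin d) (Fin d) ℝ} (hD : D.IsHermitian) : (G * D * Gᵀ).IsHermitian := by
  have h := Matrix.isHermitian_mul_mul_conjTranspose G hD
  rwa [Matrix.conjTranspose_eq_transpose_of_trivial] at h

/-- The random `k × d` matrix `G` has i.i.d. `N(0, 1/k)` entries. -/
structure IsGaussianSketch {Ω : Type*} [MeasurableSpace Ω] (P : Measure Ω) {k d : ℕ}
    (G : Ω → Matrix (Fin k) (Fin d) ℝ) : Prop where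
  hasLaw : ∀ i j, HasLaw (fun ω => G ω i j) (gaussianReal 0 ((k : ℝ≥0)⁻¹)) P
  indep : iIndepFun (fun (p : Fin k × Fin d) (ω : Ω) => G ω p.1 p.2) P

/-! Diagonalise `D = U Λ Uᵀ`. By rotation invariance `H = G U` is again a Gaussian sketch, and `G D
Gᵀ = H Λ Hᵀ`. Let `T` index `ℓ` eigenvalues that are at least `λ = λ_ℓ(D)`, let `B` index the
negative ones outside `T` with square above `1/ℓ` (at most `ℓ` of them, as `‖D‖ ≤ 1`), and put `V =
T ∪ B`.

Test vectors are `x = H_V v`. Orthogonality to the columns in `B` and to the top `ℓ - 1`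
eigenvectors of the sketch costs `|B| + ℓ - 1 < |V|` conditions, so some `v ≠ 0` survives, with
Rayleigh quotient at most `λ_ℓ(G D Gᵀ)`. For that `x` the columns in `B` contribute nothing, those
in `T` at least about `λ ‖x‖²` because `H_V` is nearly isometric, and the others lose at most the
form with weights `μ`, the negative part of `Λ` off `V` (`le_sortedEigenvalue_of_sketch`).

Both random inputs come from Chernoff bounds and nets of the unit sphere of `ℝ^V`, with `|V| ≤ 2ℓ`.
The columns off `V` are independent of `x`, so `x` can be frozen when bounding the loss; `μ i ≤
1/√ℓ` makes the exponent large enough to beat the net. -/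

/-! ### Gaussian families and Chernoff bounds for weighted sums of squares -/

/-- The real random variables `X i` are independent and `N(0, v)`-distributed. -/
structure IsCenteredGaussianFamily {Ω ι : Type*} [MeasurableSpace Ω] (P : Measure Ω)
    (X : ι → Ω → ℝ) (v : ℝ≥0) : Prop where
  hasLaw : ∀ i, HasLaw (X i) (gaussianReal 0 v) P
  indep : iIndepFun X P

/-- A linear image of a centered Gaussian family under a matrix with orthogonal rows of squared
norm `c` is again a centered Gaussian family. -/
theorem IsCenteredGaussianFamily.linear {Ω ι κ : Type*} [MeasurableSpace Ω] [Fintype ι]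
    [Finite κ] [DecidableEq κ] {P : Measure Ω} {X : ι → Ω → ℝ} {v : ℝ≥0}
    (hX : IsCenteredGaussianFamily P X v) (A : κ → ι → ℝ) (c : ℝ≥0)
    (hA : ∀ p q, ∑ i, A p i * A q i = if p = q then (c : ℝ) else 0) :
    IsCenteredGaussianFamily P (fun p ω => ∑ i, A p i * X i ω) (c * v) := by
  classical
  have : Fintype κ := Fintype.ofFinite κ
  have hg : ∀ i, HasGaussianLaw (X i) P := fun i => (hX.hasLaw i).hasGaussianLaw
  have hprob : IsProbabilityMeasure P := hX.indep.isProbabilityMeasure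
  have hmem : ∀ i, MemLp (X i) 2 P := fun i => (hg i).memLp_two
  have hmean : ∀ i, ∫ ω, X i ω ∂P = 0 := fun i => by
    rw [(hX.hasLaw i).integral_eq]; simp
  have hcov : ∀ i j, cov[X i, X j; P] = if i = j then (v : ℝ) else 0 := by
    intro i j
    split_ifs with h
    · subst h
      rw [covariance_self (hg i).aemeasurable, (hX.hasLaw i).variance_eq]
      simp
    · exact (hX.indep.indepFun h).covariance_eq_zero (hmem i) (hmem j)
  have hjoint : HasGaussianLaw (fun ω i => X i ω) P := hX.indep.hasGaussianLaw hg
  let L : (ι → ℝ) →L[ℝ] (κ → ℝ) :=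
    ContinuousLinearMap.pi fun p => ∑ i, A p i • ContinuousLinearMap.proj (R := ℝ) i
  have hL : HasGaussianLaw (fun ω p => ∑ i, A p i * X i ω) P := by
    have := hjoint.map_fun L
    have e : (fun ω => L (fun i => X i ω)) = fun ω p => ∑ i, A p i * X i ω := by
      ext ω p
      simp [L]
    rwa [e] at this
  have hcovY : ∀ p q, cov[fun ω => ∑ i, A p i * X i ω, fun ω => ∑ i, A q i * X i ω; P]
      = if p = q then (c * v : ℝ) else 0 := by
    intro p q
    rw [covariance_fun_sum_fun_sum (fun i => (hmem i).const_mul _) (fun i => (hmem i).const_mul _)]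
    simp_rw [covariance_const_mul_left, covariance_const_mul_right, hcov]
    have : ∀ i, ∑ j, A p i * (A q j * if i = j then (v : ℝ) else 0) = A p i * A q i * v := by
      intro i
      simp [mul_assoc]
    simp_rw [this]
    rw [← Finset.sum_mul, hA]
    split_ifs <;> simp
  have hYg : ∀ p, HasGaussianLaw (fun ω => ∑ i, A p i * X i ω) P := fun p => hL.eval p
  refine ⟨fun p => ⟨(hYg p).aemeasurable, ?_⟩, ?_⟩
  · rw [(hYg p).map_eq_gaussianReal]
    congr 1
    · rw [integral_finsetSum _ (fun i _ => ((hmem i).const_mul _).integrable (by norm_num))]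
      simp [integral_const_mul, hmean]
    · rw [← covariance_self (hYg p).aemeasurable, hcovY]
      simp only [if_true]
      rw [← NNReal.coe_mul, Real.toNNReal_coe]
  -- Jointly Gaussian variables that are uncorrelated are independent.
  · refine HasGaussianLaw.iIndepFun_of_covariance_eq_zero hL fun p q hpq => ?_
    rw [hcovY, if_neg hpq]

theorem integral_exp_mul_sq_gaussianReal (v : ℝ≥0) {s : ℝ} (hs : s * v ≤ 1 / 4) :
    Integrable (fun x => Real.exp (s * x ^ 2)) (gaussianReal 0 v) ∧
      ∫ x, Real.exp (s * x ^ 2) ∂gaussianReal 0 v = √(1 / (1 - 2 * (s * v))) := by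
  by_cases hv : v = 0
  · subst hv
    simp [integrable_dirac]
  have hv' : (0 : ℝ) < v := by positivity
  set b : ℝ := 1 / (2 * v) - s with hb
  have hbv : b * (2 * v) = 1 - 2 * (s * v) := by
    rw [hb]; field_simp
  have hb0 : 0 < b := by
    by_contra h
    have : b * (2 * v) ≤ 0 := mul_nonpos_of_nonpos_of_nonneg (not_lt.1 h) (by positivity)
    linarith
  have e : ∀ x : ℝ, gaussianPDFReal 0 v x * Real.exp (s * x ^ 2)
      = (√(2 * Real.pi * v))⁻¹ * Real.exp (-b * x ^ 2) := by
    intro x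
    rw [gaussianPDFReal, mul_assoc, ← Real.exp_add]
    congr 2
    rw [hb]; field_simp; ring
  constructor
  · rw [gaussianReal_of_var_ne_zero _ hv, integrable_withDensity_iff_integrable_smul'
      (by fun_prop) (ae_of_all _ fun _ => gaussianPDF_lt_top)]
    simp_rw [toReal_gaussianPDF, smul_eq_mul, e]
    exact (integrable_exp_neg_mul_sq hb0).const_mul _
  · rw [integral_gaussianReal_eq_integral_smul hv]
    simp_rw [smul_eq_mul, e]
    rw [integral_const_mul, integral_gaussian, ← Real.sqrt_inv, ← Real.sqrt_mul (by positivity)]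
    congr 1
    rw [← hbv]
    field_simp

/-- Since `(1 + u + u²)(1 - u) = 1 - u³`, the linear bound on `exp` suffices for `u < 0`; for `u ≥
0` its quadratic term is needed to absorb `u³`. -/
theorem one_div_one_sub_le_exp {u : ℝ} (hu : |u| ≤ 1 / 2) :
    1 / (1 - u) ≤ Real.exp (u + u ^ 2) := by
  obtain ⟨h1, h2⟩ := abs_le.1 hu
  rw [div_le_iff₀ (by linarith)]
  have h3 : 1 + (u + u ^ 2) ≤ Real.exp (u + u ^ 2) := by linarith [Real.add_one_le_exp (u + u ^ 2)]
  rcases le_or_gt 0 u with h0 | h0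
  · have h4 := Real.quadratic_le_exp_of_nonneg (x := u + u ^ 2) (by positivity)
    have : 1 ≤ (1 + (u + u ^ 2) + (u + u ^ 2) ^ 2 / 2) * (1 - u) := by
      nlinarith [sq_nonneg u, mul_nonneg (sq_nonneg u) (by linarith : 0 ≤ 1 / 2 - u), pow_nonneg h0 3, mul_nonneg (pow_nonneg h0 3) (by linarith : 0 ≤ 1 / 2 - u), mul_nonneg (pow_nonneg h0 4) (by linarith : 0 ≤ 1 / 2 - u)]
    exact this.trans (mul_le_mul_of_nonneg_right h4 (by linarith))
  · have : 1 ≤ (1 + (u + u ^ 2)) * (1 - u) := by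
      nlinarith [mul_nonneg (sq_nonneg u) (by linarith : 0 ≤ -u)]
    exact this.trans (mul_le_mul_of_nonneg_right h3 (by linarith))

theorem integral_exp_mul_sq_gaussianReal_le (v : ℝ≥0) {s : ℝ} (hs : |s| * v ≤ 1 / 4) :
    ∫ x, Real.exp (s * x ^ 2) ∂gaussianReal 0 v ≤ Real.exp (s * v + 2 * (s * v) ^ 2) := by
  have h : |s * v| ≤ 1 / 4 := by rwa [abs_mul, NNReal.abs_eq]
  rw [(integral_exp_mul_sq_gaussianReal v ((le_abs_self _).trans h)).2]
  apply Real.sqrt_le_iff.2 ⟨(Real.exp_pos _).le, ?_⟩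
  refine (one_div_one_sub_le_exp (u := 2 * (s * v)) ?_).trans_eq ?_
  · rw [abs_mul, abs_two]; linarith
  · rw [← Real.exp_nat_mul]
    congr 1
    push_cast
    ring

/-- Chernoff bound for weighted sums of squares of independent Gaussian variables. -/
theorem IsCenteredGaussianFamily.measureReal_le_sum_sq {Ω ι : Type*} [MeasurableSpace Ω]
    [Fintype ι] {P : Measure Ω} {Y : ι → Ω → ℝ} {v : ℝ≥0}
    (hY : IsCenteredGaussianFamily P Y v) (w : ι → ℝ) (hw : ∀ i, |w i| * v ≤ 1 / 4) (a : ℝ) :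
    P.real {ω | a ≤ ∑ i, w i * Y i ω ^ 2} ≤
      Real.exp (-a + v * ∑ i, w i + 2 * v ^ 2 * ∑ i, w i ^ 2) := by
  have hprob : IsProbabilityMeasure P := hY.indep.isProbabilityMeasure
  have hm : ∀ i, AEMeasurable (Y i) P := fun i => (hY.hasLaw i).aemeasurable
  have hind : iIndepFun (fun i ω => w i * Y i ω ^ 2) P :=
    hY.indep.comp (fun i x => w i * x ^ 2) (fun i => by fun_prop)
  have hm' : ∀ i, AEMeasurable (fun ω => w i * Y i ω ^ 2) P := fun i => by
    have := hm i
    fun_prop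
  have hint : ∀ i, Integrable (fun ω => Real.exp (1 * (w i * Y i ω ^ 2))) P := by
    intro i
    have h1 := (integral_exp_mul_sq_gaussianReal v (s := w i)
      ((mul_le_mul_of_nonneg_right (le_abs_self _) v.2).trans (hw i))).1
    rw [← (hY.hasLaw i).map_eq] at h1
    simpa [Function.comp_def] using h1.comp_aemeasurable (hm i)
  have hmgf : ∀ i, mgf (fun ω => w i * Y i ω ^ 2) P 1 ≤
      Real.exp (w i * v + 2 * (w i * v) ^ 2) := by
    intro i
    refine le_trans (le_of_eq ?_) (integral_exp_mul_sq_gaussianReal_le v (hw i))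
    rw [mgf, ← (hY.hasLaw i).map_eq, integral_map (hm i) (by fun_prop)]
    simp
  have h := measure_ge_le_exp_mul_mgf (μ := P) (X := ∑ i, fun ω => w i * Y i ω ^ 2) (t := 1) a
    zero_le_one ?_
  · simp only [Finset.sum_apply] at h
    refine h.trans ?_
    rw [hind.mgf_sum₀ hm']
    calc _ ≤ Real.exp (-1 * a) * ∏ i, Real.exp (w i * v + 2 * (w i * v) ^ 2) := by
          gcongr with i
          · exact fun _ _ => mgf_nonneg
          · exact hmgf i
      _ = _ := by
          rw [← Real.exp_sum, ← Real.exp_add, Finset.sum_add_distrib, Finset.mul_sum,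
            Finset.mul_sum, add_assoc]
          congr 2
          · ring
          · congr 1 <;> exact Finset.sum_congr rfl fun i _ => by ring
  -- A non-integrable exponential would have `mgf` equal to the default value `0`, but the product
  -- of the factors is positive.
  · by_contra hni
    have hpos : 0 < ∏ i, mgf (fun ω => w i * Y i ω ^ 2) P 1 :=
      Finset.prod_pos fun i _ => mgf_pos (hint i)
    rw [← hind.mgf_sum₀ hm', mgf_undef hni] at hpos
    exact lt_irrefl _ hpos

/-! ### Nets and operator norms -/

section Nets

/-- The unit sphere of an `n`-dimensional normed space has a `1/2`-net with at most `5 ^ n` points. -/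
theorem exists_half_net_sphere (E : Type*) [NormedAddCommGroup E] [NormedSpace ℝ E]
    [FiniteDimensional ℝ E] :
    ∃ N : Finset E, N.card ≤ 5 ^ Module.finrank ℝ E ∧
      ∀ x : E, ‖x‖ = 1 → ∃ y ∈ N, ‖y‖ = 1 ∧ ‖x - y‖ ≤ 1 / 2 := by
  classical
  -- A largest 1-separated set on the sphere of radius 2 is a 1-net there; this is the scale of
  -- `Besicovitch.card_le_of_separated`, and halving gives the net.
  let Q : ℕ → Prop := fun m => ∃ s : Finset E, s.card = m ∧ (∀ c ∈ s, ‖c‖ = 2) ∧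
    ∀ c ∈ s, ∀ d ∈ s, c ≠ d → 1 ≤ ‖c - d‖
  have hQ0 : Q 0 := ⟨∅, by simp⟩
  have hbd : ∀ m, Q m → m ≤ 5 ^ Module.finrank ℝ E := by
    rintro m ⟨s, rfl, h1, h2⟩
    exact Besicovitch.card_le_of_separated s (fun c hc => (h1 c hc).le) h2
  obtain ⟨s, hs, h1, h2⟩ : Q (Nat.findGreatest Q (5 ^ Module.finrank ℝ E)) :=
    Nat.findGreatest_spec (Nat.zero_le _) hQ0
  have hmax : ∀ x : E, ‖x‖ = 2 → ∃ y ∈ s, ‖x - y‖ ≤ 1 := by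
    intro x hx
    by_contra! hcon
    have hxs : x ∉ s := fun h => by
      have := hcon x h
      simp at this
      linarith
    have hQ : Q (s.card + 1) := by
      refine ⟨insert x s, Finset.card_insert_of_notMem hxs, ?_, ?_⟩
      · intro c hc
        rcases Finset.mem_insert.1 hc with rfl | hc
        exacts [hx, h1 c hc]
      · intro c hc d hd hcd
        rcases Finset.mem_insert.1 hc with hc' | hc' <;>
          rcases Finset.mem_insert.1 hd with hd' | hd'
        · exact absurd (hc'.trans hd'.symm) hcd
        · rw [hc']; exact (hcon d hd').le
        · rw [hd', norm_sub_rev]; exact (hcon c hc').le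
        · exact h2 c hc' d hd' hcd
    have := Nat.le_findGreatest (hbd _ hQ) hQ
    omega
  refine ⟨s.image fun y => (1 / 2 : ℝ) • y, ?_, ?_⟩
  · exact Finset.card_image_le.trans (hs.le.trans (Nat.findGreatest_le _))
  · intro x hx
    obtain ⟨y, hy, hxy⟩ := hmax ((2 : ℝ) • x) (by rw [norm_smul, hx]; norm_num)
    refine ⟨_, Finset.mem_image_of_mem _ hy, by rw [norm_smul, h1 y hy]; norm_num, ?_⟩
    have : x - (1 / 2 : ℝ) • y = (1 / 2 : ℝ) • ((2 : ℝ) • x - y) := by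
      rw [smul_sub, smul_smul]; norm_num
    rw [this, norm_smul]
    norm_num
    exact hxy

variable {E F : Type*} [NormedAddCommGroup E]

/-- Moving a unit vector to the net costs at most `‖f‖ / 2`, which is absorbed on the left. -/
theorem ContinuousLinearMap.opNorm_le_two_mul_of_half_net [NormedSpace ℝ E]
    [NormedAddCommGroup F] [NormedSpace ℝ F] {N : Finset E}
    (hN : ∀ x : E, ‖x‖ = 1 → ∃ y ∈ N, ‖y‖ = 1 ∧ ‖x - y‖ ≤ 1 / 2) (f : E →L[ℝ] F) {c : ℝ}
    (hc : 0 ≤ c) (h : ∀ y ∈ N, ‖y‖ = 1 → ‖f y‖ ≤ c) : ‖f‖ ≤ 2 * c := by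
  have : ‖f‖ ≤ c + ‖f‖ * (1 / 2) := by
    refine f.opNorm_le_of_unit_norm (by positivity) fun x hx => ?_
    obtain ⟨y, hy, hy1, hxy⟩ := hN x hx
    calc ‖f x‖ = ‖f y + f (x - y)‖ := by simp
      _ ≤ ‖f y‖ + ‖f (x - y)‖ := norm_add_le _ _
      _ ≤ c + ‖f‖ * (1 / 2) := by
          gcongr
          · exact h y hy hy1
          · exact (f.le_opNorm _).trans (by gcongr)
  linarith

variable [InnerProductSpace ℝ E]

open scoped RealInnerProductSpace in
-- Polarisation and the parallelogram law bound the bilinear form of `SᵀS - 1` by `t` on pairs of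
-- net points; each of its two arguments then costs a factor 2 in passing to the whole sphere.
theorem abs_norm_sq_sub_norm_sq_le_of_half_net [CompleteSpace E] [NormedAddCommGroup F]
    [InnerProductSpace ℝ F] [CompleteSpace F] {N : Finset E}
    (hN : ∀ x : E, ‖x‖ = 1 → ∃ y ∈ N, ‖y‖ = 1 ∧ ‖x - y‖ ≤ 1 / 2) (S : E →L[ℝ] F) {t : ℝ}
    (ht : 0 ≤ t)
    (h : ∀ y ∈ N, ∀ z ∈ N, |‖S (y + z)‖ ^ 2 - ‖y + z‖ ^ 2| ≤ t * ‖y + z‖ ^ 2 ∧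
      |‖S (y - z)‖ ^ 2 - ‖y - z‖ ^ 2| ≤ t * ‖y - z‖ ^ 2) (v : E) :
    |‖S v‖ ^ 2 - ‖v‖ ^ 2| ≤ 4 * t * ‖v‖ ^ 2 := by
  let T : E →L[ℝ] E := S.adjoint ∘L S - ContinuousLinearMap.id ℝ E
  have hT : ∀ y z, ⟪T y, z⟫ = ⟪S y, S z⟫ - ⟪y, z⟫ := by
    intro y z
    simp [T, inner_sub_left, ContinuousLinearMap.adjoint_inner_left]
  have hyz : ∀ y ∈ N, ‖y‖ = 1 → ∀ z ∈ N, ‖z‖ = 1 → |⟪T y, z⟫| ≤ t := by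
    intro y hy hy1 z hz hz1
    obtain ⟨h1, h2⟩ := h y hy z hz
    have e1 := norm_add_sq_real y z
    have e2 := norm_sub_sq_real y z
    have e3 := norm_add_sq_real (S y) (S z)
    have e4 := norm_sub_sq_real (S y) (S z)
    rw [← map_add] at e3
    rw [← map_sub] at e4
    rw [hy1, hz1] at e1 e2
    rw [hT]
    rw [abs_le] at h1 h2 ⊢
    constructor <;> nlinarith
  have hTn : ‖T‖ ≤ 2 * (2 * t) := by
    refine T.opNorm_le_two_mul_of_half_net hN (by positivity) fun y hy hy1 => ?_
    rw [← innerSL_apply_norm ℝ (T y)]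
    exact (innerSL ℝ (T y)).opNorm_le_two_mul_of_half_net hN ht fun z hz hz1 => by
      simpa using hyz y hy hy1 z hz hz1
  have hv := hT v v
  rw [real_inner_self_eq_norm_sq, real_inner_self_eq_norm_sq] at hv
  rw [← hv]
  calc |⟪T v, v⟫| ≤ ‖T v‖ * ‖v‖ := abs_real_inner_le_norm _ _
    _ ≤ (‖T‖ * ‖v‖) * ‖v‖ := by gcongr; exact T.le_opNorm v
    _ ≤ (2 * (2 * t) * ‖v‖) * ‖v‖ := by gcongr
    _ = 4 * t * ‖v‖ ^ 2 := by ring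

end Nets

/-! ### Spectral facts and the deterministic lower bound -/

theorem Matrix.IsHermitian.dotProduct_mulVec_eq_sum_eigenvalues {n : ℕ}
    {A : Matrix (Fin n) (Fin n) ℝ} (hA : A.IsHermitian) (x : Fin n → ℝ) :
    x ⬝ᵥ A *ᵥ x = ∑ j, hA.eigenvalues j * (⇑(hA.eigenvectorBasis j) ⬝ᵥ x) ^ 2 := by
  have h := (hA.eigenvectorBasis).sum_inner_mul_inner (WithLp.toLp 2 x) (WithLp.toLp 2 (A *ᵥ x))
  simp only [EuclideanSpace.inner_eq_star_dotProduct, star_trivial] at h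
  rw [dotProduct_comm, ← h]
  refine Finset.sum_congr rfl fun j _ => ?_
  have : A *ᵥ x ⬝ᵥ ⇑(hA.eigenvectorBasis j)
      = hA.eigenvalues j * (⇑(hA.eigenvectorBasis j) ⬝ᵥ x) := by
    rw [dotProduct_comm, Matrix.dotProduct_mulVec, ← Matrix.mulVec_transpose,
      ← Matrix.conjTranspose_eq_transpose_of_trivial, hA.eq, hA.mulVec_eigenvectorBasis,
      smul_dotProduct, smul_eq_mul]
  rw [this]
  ring

theorem Matrix.IsHermitian.dotProduct_self_eq_sum_eigenvectorBasis {n : ℕ}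
    {A : Matrix (Fin n) (Fin n) ℝ} (hA : A.IsHermitian) (x : Fin n → ℝ) :
    x ⬝ᵥ x = ∑ j, (⇑(hA.eigenvectorBasis j) ⬝ᵥ x) ^ 2 := by
  have h := (hA.eigenvectorBasis).sum_inner_mul_inner (WithLp.toLp 2 x) (WithLp.toLp 2 x)
  simp only [EuclideanSpace.inner_eq_star_dotProduct, star_trivial] at h
  rw [← h]
  refine Finset.sum_congr rfl fun j _ => ?_
  rw [dotProduct_comm x, sq]

/-- `eigenvalues` relabels the sorted list along an equivalence that need not preserve order;
keeping it as a named `e` transfers the ordering. -/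
theorem sortedEigenvalue_eq_eigenvalues {n : ℕ} {A : Matrix (Fin n) (Fin n) ℝ}
    (hA : A.IsHermitian) (e : Fin (Fintype.card (Fin n)) ≃ Fin n)
    (he : e = Fintype.equivOfCardEq (Fintype.card_fin _)) (i : Fin (Fintype.card (Fin n))) :
    hA.eigenvalues (e i) = hA.eigenvalues₀ i := by
  subst he
  simp [Matrix.IsHermitian.eigenvalues]

/-- A variational upper bound in the style of Courant and Fischer: on a space which is too large
for fewer than `ℓ` linear conditions together with the conditions `g v = 0`, some nonzero vector
satisfies the latter and has Rayleigh quotient at most `λ_ℓ(A)`. -/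
theorem exists_dotProduct_mulVec_le_sortedEigenvalue {n : ℕ} {A : Matrix (Fin n) (Fin n) ℝ}
    (hA : A.IsHermitian) (ℓ : ℕ) (h1 : 1 ≤ ℓ) (hn : ℓ ≤ n) {E F : Type*} [AddCommGroup E]
    [Module ℝ E] [FiniteDimensional ℝ E] [AddCommGroup F] [Module ℝ F] [FiniteDimensional ℝ F]
    (f : E →ₗ[ℝ] Fin n → ℝ) (g : E →ₗ[ℝ] F)
    (hdim : Module.finrank ℝ F + (ℓ - 1) < Module.finrank ℝ E) :
    ∃ v : E, v ≠ 0 ∧ g v = 0 ∧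
      f v ⬝ᵥ A *ᵥ f v ≤ sortedEigenvalue hA ℓ h1 hn * (f v ⬝ᵥ f v) := by
  obtain ⟨e, he⟩ : ∃ e : Fin (Fintype.card (Fin n)) ≃ Fin n,
    e = Fintype.equivOfCardEq (Fintype.card_fin _) := ⟨_, rfl⟩
  let c : Fin (ℓ - 1) → Fin n := fun i => e ⟨i, by rw [Fintype.card_fin]; omega⟩
  let p : (Fin n → ℝ) →ₗ[ℝ] Fin (ℓ - 1) → ℝ :=
    (Matrix.of fun i => ⇑(hA.eigenvectorBasis (c i))).mulVecLin
  have hker : LinearMap.ker (g.prod (p ∘ₗ f)) ≠ ⊥ :=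
    LinearMap.ker_ne_bot_of_finrank_lt (by simpa using hdim)
  obtain ⟨v, hv, hv0⟩ := (Submodule.ne_bot_iff _).1 hker
  replace hv := Prod.mk_eq_zero.1 (LinearMap.mem_ker.1 hv)
  refine ⟨v, hv0, hv.1, ?_⟩
  rw [hA.dotProduct_mulVec_eq_sum_eigenvalues, hA.dotProduct_self_eq_sum_eigenvectorBasis,
    Finset.mul_sum]
  refine Finset.sum_le_sum fun j _ => ?_
  obtain ⟨i, rfl⟩ := e.surjective j
  rcases lt_or_ge i.1 (ℓ - 1) with hi | hi
  · have : ⇑(hA.eigenvectorBasis (e i)) ⬝ᵥ f v = 0 := congrFun hv.2 ⟨i.1, hi⟩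
    rw [this]
    simp
  · rw [sortedEigenvalue_eq_eigenvalues hA e he]
    exact mul_le_mul_of_nonneg_right (hA.eigenvalues₀_antitone hi) (sq_nonneg _)

/-- Both sides are the trace of `D * D`. -/
theorem Matrix.IsHermitian.sum_sq_eigenvalues_eq_frobenius_norm_sq {n : ℕ} {D : Matrix (Fin n) (Fin n) ℝ} (hD : D.IsHermitian) :
    ∑ i, hD.eigenvalues i ^ 2 = ‖D‖ ^ 2 := by
  have h1 : ‖D‖ ^ 2 = ∑ i, ∑ j, D i j ^ 2 := by
    rw [Matrix.frobenius_norm_def, ← Real.sqrt_eq_rpow, Real.sq_sqrt (by positivity)]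
    simp
  have h2 : ∑ i, ∑ j, D i j ^ 2 = (D * D).trace := by
    simp only [Matrix.trace, Matrix.diag, Matrix.mul_apply]
    refine Finset.sum_congr rfl fun i _ => Finset.sum_congr rfl fun j _ => ?_
    rw [sq, ← hD.apply i j]
    simp
  have h3 : (D * D).trace = ∑ i, hD.eigenvalues i ^ 2 := by
    conv_lhs => rw [hD.spectral_theorem]
    rw [← map_mul, Unitary.conjStarAlgAut_apply, Matrix.trace_mul_cycle]
    simp [Matrix.diagonal_mul_diagonal, sq]
  rw [h1, h2, h3]

/-- If `GDGᵀ = H Λ Hᵀ` with `Λ` diagonal, then `λ_ℓ` of it is bounded from below as soon as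
`H` is nearly isometric on the coordinates `V = T ∪ B` and the negative part of `Λ` off `V`
contributes little on the image of these coordinates. -/
theorem le_sortedEigenvalue_of_sketch {k d : ℕ} {M : Matrix (Fin k) (Fin k) ℝ}
    (hM : M.IsHermitian) (H : Matrix (Fin k) (Fin d) ℝ) (Λ : Fin d → ℝ)
    (hMH : M = H * Matrix.diagonal Λ * Hᵀ) (ℓ : ℕ) (h1 : 1 ≤ ℓ) (hk : ℓ ≤ k)
    (T B : Finset (Fin d)) (hTB : Disjoint T B) (hT : T.card = ℓ) {lam δ η : ℝ} (hlam : 0 ≤ lam)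
    (hΛ : ∀ i ∈ T, lam ≤ Λ i) (μ : Fin d → ℝ) (hμ : ∀ i, 0 ≤ μ i)
    (hΛμ : ∀ i, i ∉ T → i ∉ B → -μ i ≤ Λ i) (hδ : δ < 1)
    (hiso : ∀ v : ↥(T ∪ B) → ℝ, (1 - δ) * (v ⬝ᵥ v) ≤
      (H.submatrix id Subtype.val *ᵥ v) ⬝ᵥ (H.submatrix id Subtype.val *ᵥ v))
    (hrest : ∀ v : ↥(T ∪ B) → ℝ,
      ∑ i, μ i * ((Hᵀ *ᵥ (H.submatrix id (Subtype.val : ↥(T ∪ B) → Fin d) *ᵥ v)) i) ^ 2 ≤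
      η * ((H.submatrix id Subtype.val *ᵥ v) ⬝ᵥ (H.submatrix id Subtype.val *ᵥ v))) :
    lam * (1 - δ) - η ≤ sortedEigenvalue hM ℓ h1 hk := by
  classical
  set HV : Matrix (Fin k) ↥(T ∪ B) ℝ := H.submatrix id Subtype.val with hHV
  let f := HV.mulVecLin
  let g : (↥(T ∪ B) → ℝ) →ₗ[ℝ] (↥B → ℝ) :=
    (H.submatrix id (Subtype.val : ↥B → Fin d))ᵀ.mulVecLin ∘ₗ f
  obtain ⟨v, hv0, hgv, hv⟩ := exists_dotProduct_mulVec_le_sortedEigenvalue hM ℓ h1 hk f g (by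
    simp only [Module.finrank_fintype_fun_eq_card, Fintype.card_coe]
    rw [Finset.card_union_of_disjoint hTB]
    omega)
  set x : Fin k → ℝ := HV *ᵥ v with hx
  have hfx : f v = x := rfl
  rw [hfx] at hv
  set y : Fin d → ℝ := Hᵀ *ᵥ x with hy
  have hyB : ∀ i ∈ B, y i = 0 := fun i hi => congrFun hgv ⟨i, hi⟩
  have hxMx : x ⬝ᵥ M *ᵥ x = ∑ i, Λ i * y i ^ 2 := by
    rw [hMH, ← Matrix.mulVec_mulVec, ← Matrix.mulVec_mulVec, Matrix.dotProduct_mulVec,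
      ← Matrix.mulVec_transpose, ← hy]
    simp only [dotProduct, Matrix.mulVec_diagonal]
    exact Finset.sum_congr rfl fun i _ => by ring
  have hvv : 0 < v ⬝ᵥ v := by
    simpa using Matrix.dotProduct_star_self_pos_iff.2 hv0
  have hxx : 0 < x ⬝ᵥ x := lt_of_lt_of_le (mul_pos (by linarith) hvv) (hiso v)
  have hxv : x ⬝ᵥ x = ∑ i, v i * y i.1 := by
    nth_rewrite 2 [hx]
    rw [Matrix.dotProduct_mulVec, ← Matrix.mulVec_transpose, dotProduct_comm]
    rfl
  have hyT : ∑ i : ↥(T ∪ B), y i.1 ^ 2 = ∑ i ∈ T, y i ^ 2 := by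
    rw [Finset.sum_coe_sort (T ∪ B) (fun i => y i ^ 2), Finset.sum_union hTB]
    simp [Finset.sum_eq_zero fun i hi => show y i ^ 2 = 0 by rw [hyB i hi]; simp]
  -- Since `‖x‖² = ⟨v, H_Vᵀ x⟩` and the `B`-coordinates of `Hᵀ x` vanish, Cauchy–Schwarz leaves only
  -- those in `T`.
  have hcs : (x ⬝ᵥ x) ^ 2 ≤ (v ⬝ᵥ v) * ∑ i ∈ T, y i ^ 2 := by
    rw [hxv, ← hyT]
    refine (Finset.sum_mul_sq_le_sq_mul_sq _ _ _).trans_eq ?_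
    simp [dotProduct, sq]
  have hS0 : 0 ≤ ∑ i ∈ T, y i ^ 2 := Finset.sum_nonneg fun i _ => sq_nonneg _
  have hlow : (1 - δ) * (x ⬝ᵥ x) ≤ ∑ i ∈ T, y i ^ 2 := by
    have h1 := mul_le_mul_of_nonneg_right (hiso v) hS0
    have h2 : (1 - δ) * (x ⬝ᵥ x) ^ 2 ≤ (x ⬝ᵥ x) * ∑ i ∈ T, y i ^ 2 := by
      nlinarith
    refine le_of_mul_le_mul_left ?_ hxx
    nlinarith
  have hsum : lam * ∑ i ∈ T, y i ^ 2 - ∑ i, μ i * y i ^ 2 ≤ ∑ i, Λ i * y i ^ 2 := by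
    have e : lam * ∑ i ∈ T, y i ^ 2 = ∑ i, if i ∈ T then lam * y i ^ 2 else 0 := by
      rw [Finset.mul_sum, Finset.sum_ite_mem, Finset.univ_inter]
    rw [e, ← Finset.sum_sub_distrib]
    refine Finset.sum_le_sum fun i _ => ?_
    have hμy := mul_nonneg (hμ i) (sq_nonneg (y i))
    split_ifs with hi
    · have := mul_le_mul_of_nonneg_right (hΛ i hi) (sq_nonneg (y i))
      linarith
    · by_cases hiB : i ∈ B
      · rw [hyB i hiB]; simp
      · have := mul_le_mul_of_nonneg_right (hΛμ i hi hiB) (sq_nonneg (y i))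
        linarith
  have hr := hrest v
  refine le_of_mul_le_mul_right ?_ hxx
  have := mul_le_mul_of_nonneg_left hlow hlam
  rw [hxMx] at hv
  linarith

/-! ### Concentration for a fixed vector -/

/-- Two-sided concentration of the sum of squares of a centered Gaussian family. -/
theorem IsCenteredGaussianFamily.measureReal_abs_sum_sq_sub_le {Ω ι : Type*} [MeasurableSpace Ω]
    [Fintype ι] {P : Measure Ω} {Y : ι → Ω → ℝ} {v : ℝ≥0} (hY : IsCenteredGaussianFamily P Y v)
    (hv : v ≠ 0) {t : ℝ} (ht0 : 0 ≤ t) (ht1 : t ≤ 1) :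
    P.real {ω | t * (Fintype.card ι * v) < |∑ i, Y i ω ^ 2 - Fintype.card ι * v|} ≤
      2 * Real.exp (-(Fintype.card ι * t ^ 2 / 8)) := by
  have hprob : IsProbabilityMeasure P := hY.indep.isProbabilityMeasure
  have hv' : (0 : ℝ) < v := by positivity
  set n : ℝ := (Fintype.card ι : ℝ) with hn
  -- The weight `t / (4v)` minimises the Chernoff exponent `-w t n v + 2 w² n v²`, with value `-n t²
  -- / 8`.
  have hw : |t / (4 * v)| * v ≤ 1 / 4 := by
    rw [abs_of_nonneg (by positivity)]
    field_simp
    linarith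
  have hup := hY.measureReal_le_sum_sq (fun _ => t / (4 * v)) (fun _ => hw)
    (t / (4 * v) * ((1 + t) * (n * v)))
  have hlo := hY.measureReal_le_sum_sq (fun _ => -(t / (4 * v)))
    (fun _ => by rw [abs_neg]; exact hw) (-(t / (4 * v)) * ((1 - t) * (n * v)))
  simp only [Finset.sum_const, Finset.card_univ, nsmul_eq_mul, ← Finset.mul_sum] at hup hlo
  rw [← hn] at hup hlo
  have e1 : -(t / (4 * v) * ((1 + t) * (n * v))) + v * (n * (t / (4 * v))) +
      2 * (v : ℝ) ^ 2 * (n * (t / (4 * v)) ^ 2) = -(n * t ^ 2 / 8) := by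
    field_simp; ring
  have e2 : -(-(t / (4 * v)) * ((1 - t) * (n * v))) + v * (n * -(t / (4 * v))) +
      2 * (v : ℝ) ^ 2 * (n * (-(t / (4 * v))) ^ 2) = -(n * t ^ 2 / 8) := by
    field_simp; ring
  rw [e1] at hup
  rw [e2] at hlo
  rw [two_mul]
  refine le_trans ?_ (add_le_add hup hlo)
  refine (measureReal_mono ?_).trans (measureReal_union_le _ _)
  intro ω hω
  have hs : 0 ≤ t / (4 * (v : ℝ)) := by positivity
  rw [Set.mem_ofPred_eq] at hω
  rcases lt_abs.1 hω with h | h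
  · left
    rw [Set.mem_ofPred_eq]
    exact mul_le_mul_of_nonneg_left (by linarith) hs
  · right
    have := mul_le_mul_of_nonneg_left (show ∑ i, Y i ω ^ 2 ≤ (1 - t) * (n * v) by linarith) hs
    rw [Set.mem_ofPred_eq]
    linarith

/-- Fubini for the product law: a bound uniform over frozen values of `f` survives averaging. -/
theorem ProbabilityTheory.IndepFun.measureReal_mem_le {Ω α β : Type*} [MeasurableSpace Ω]
    [MeasurableSpace α] [MeasurableSpace β] {P : Measure Ω} [IsProbabilityMeasure P]
    {f : Ω → α} {g : Ω → β} (h : IndepFun f g P) (hf : AEMeasurable f P) (hg : AEMeasurable g P)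
    {s : Set (α × β)} (hs : MeasurableSet s) {c : ℝ} (hc : ∀ a, P.real {ω | (a, g ω) ∈ s} ≤ c) :
    P.real {ω | (f ω, g ω) ∈ s} ≤ c := by
  have : IsProbabilityMeasure (P.map f) := Measure.isProbabilityMeasure_map hf
  have : IsProbabilityMeasure (P.map g) := Measure.isProbabilityMeasure_map hg
  have : Nonempty α := (Measure.nonempty_of_neZero (P.map f))
  have hc0 : 0 ≤ c := measureReal_nonneg.trans (hc (Classical.arbitrary α))
  refine ENNReal.toReal_le_of_le_ofReal hc0 ?_
  have e : P {ω | (f ω, g ω) ∈ s} = P.map (fun ω => (f ω, g ω)) s :=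
    (Measure.map_apply_of_aemeasurable (hf.prodMk hg) hs).symm
  rw [e, (indepFun_iff_map_prod_eq_prod_map_map hf hg).1 h, Measure.prod_apply hs]
  calc _ ≤ ∫⁻ _, ENNReal.ofReal c ∂P.map f := by
        refine lintegral_mono fun a => ?_
        rw [Measure.map_apply_of_aemeasurable hg (measurable_prodMk_left hs)]
        exact (ENNReal.le_ofReal_iff_toReal_le (measure_ne_top _ _) hc0).2 (hc a)
    _ = _ := by simp

section Sketch

variable {Ω : Type*} [MeasurableSpace Ω] {P : Measure Ω} {k d : ℕ}
  {G : Ω → Matrix (Fin k) (Fin d) ℝ}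

theorem IsGaussianSketch.isCenteredGaussianFamily (hG : IsGaussianSketch P G) :
    IsCenteredGaussianFamily P (fun (p : Fin k × Fin d) ω => G ω p.1 p.2) ((k : ℝ≥0)⁻¹) :=
  ⟨fun p => hG.hasLaw p.1 p.2, hG.indep⟩

/-- Rotation invariance of the Gaussian sketch. -/
theorem IsGaussianSketch.mul_orthogonal (hG : IsGaussianSketch P G)
    {U : Matrix (Fin d) (Fin d) ℝ} (hU : Uᵀ * U = 1) :
    IsGaussianSketch P (fun ω => G ω * U) := by
  have h := hG.isCenteredGaussianFamily.linear
    (fun (p q : Fin k × Fin d) => if q.1 = p.1 then U q.2 p.2 else 0) 1 (by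
      rintro ⟨a, i⟩ ⟨b, j⟩
      have hij : ∑ x, U x i * U x j = if i = j then 1 else 0 := by
        have := congrFun (congrFun hU i) j
        rwa [Matrix.mul_apply, Matrix.one_apply] at this
      by_cases hab : a = b
      · subst hab
        simp [Fintype.sum_prod_type, hij]
      · simp [Fintype.sum_prod_type, hab, Ne.symm hab])
  have e : (fun (p : Fin k × Fin d) ω =>
      ∑ q : Fin k × Fin d, (if q.1 = p.1 then U q.2 p.2 else 0) * G ω q.1 q.2) =
      fun (p : Fin k × Fin d) ω => (G ω * U) p.1 p.2 := by
    ext p ω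
    simp [Fintype.sum_prod_type, Matrix.mul_apply, mul_comm]
  rw [e, one_mul] at h
  exact ⟨fun i j => h.hasLaw (i, j), h.indep⟩

theorem IsGaussianSketch.mulVec (hG : IsGaussianSketch P G) (u : Fin d → ℝ) :
    IsCenteredGaussianFamily P (fun a ω => (G ω *ᵥ u) a)
      (Real.toNNReal (u ⬝ᵥ u) * (k : ℝ≥0)⁻¹) := by
  have h := hG.isCenteredGaussianFamily.linear
    (fun (p : Fin k) (q : Fin k × Fin d) => if q.1 = p then u q.2 else 0) (Real.toNNReal (u ⬝ᵥ u))
    (by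
      intro a b
      rw [Real.coe_toNNReal _ (by simpa using dotProduct_star_self_nonneg u)]
      by_cases hab : a = b
      · subst hab
        simp [Fintype.sum_prod_type, dotProduct]
      · simp [Fintype.sum_prod_type, hab, Ne.symm hab])
  convert h using 3
  simp [Fintype.sum_prod_type, Matrix.mulVec, dotProduct, mul_comm]

theorem IsGaussianSketch.transpose_mulVec (hG : IsGaussianSketch P G) (x : Fin k → ℝ) :
    IsCenteredGaussianFamily P (fun i ω => ((G ω)ᵀ *ᵥ x) i)
      (Real.toNNReal (x ⬝ᵥ x) * (k : ℝ≥0)⁻¹) := by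
  have h := hG.isCenteredGaussianFamily.linear
    (fun (p : Fin d) (q : Fin k × Fin d) => if q.2 = p then x q.1 else 0) (Real.toNNReal (x ⬝ᵥ x))
    (by
      intro a b
      rw [Real.coe_toNNReal _ (by simpa using dotProduct_star_self_nonneg x)]
      by_cases hab : a = b
      · subst hab
        simp [Fintype.sum_prod_type, dotProduct]
      · simp [Fintype.sum_prod_type, hab, Ne.symm hab])
  convert h using 3
  simp [Fintype.sum_prod_type, Matrix.mulVec, dotProduct, mul_comm]

theorem IsGaussianSketch.measureReal_norm_sq_le (hG : IsGaussianSketch P G) (hk : 0 < k)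
    (u : Fin d → ℝ) {t : ℝ} (ht0 : 0 ≤ t) (ht1 : t ≤ 1) :
    P.real {ω | t * (u ⬝ᵥ u) < |(G ω *ᵥ u) ⬝ᵥ (G ω *ᵥ u) - u ⬝ᵥ u|} ≤
      2 * Real.exp (-(k * t ^ 2 / 8)) := by
  by_cases hu : u = 0
  · subst hu
    simp
    positivity
  have huu : 0 < u ⬝ᵥ u := by simpa using Matrix.dotProduct_star_self_pos_iff.2 hu
  have hk' : (0 : ℝ) < k := by exact_mod_cast hk
  have h := (hG.mulVec u).measureReal_abs_sum_sq_sub_le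
    (mul_ne_zero (Real.toNNReal_pos.2 huu).ne' (by positivity)) ht0 ht1
  have e : ((Fintype.card (Fin k) : ℕ) : ℝ) * ((Real.toNNReal (u ⬝ᵥ u) * (k : ℝ≥0)⁻¹ : ℝ≥0) : ℝ)
      = u ⬝ᵥ u := by
    rw [Fintype.card_fin, NNReal.coe_mul, Real.coe_toNNReal _ huu.le]
    push_cast
    field_simp
  rw [e, Fintype.card_fin] at h
  simpa only [dotProduct, sq] using h

theorem IsGaussianSketch.measureReal_weighted_le (hG : IsGaussianSketch P G) (hk : 0 < k)
    (x : Fin k → ℝ) (μ : Fin d → ℝ) (hμ : ∀ i, 0 ≤ μ i) {s τ : ℝ} (hs : 0 ≤ s)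
    (hsμ : ∀ i, s * μ i ≤ 1 / 4) :
    P.real {ω | τ * (x ⬝ᵥ x) < ∑ i, μ i * (((G ω)ᵀ *ᵥ x) i) ^ 2} ≤
      Real.exp (-(s * τ * k) + s * ∑ i, μ i + 2 * s ^ 2 * ∑ i, μ i ^ 2) := by
  have hprob : IsProbabilityMeasure P := hG.indep.isProbabilityMeasure
  by_cases hx : x = 0
  · subst hx
    simp
    positivity
  have hxx : 0 < x ⬝ᵥ x := by simpa using Matrix.dotProduct_star_self_pos_iff.2 hx
  have hk' : (0 : ℝ) < k := by exact_mod_cast hk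
  set v : ℝ≥0 := Real.toNNReal (x ⬝ᵥ x) * (k : ℝ≥0)⁻¹ with hv
  have hv' : (v : ℝ) = (x ⬝ᵥ x) / k := by
    rw [hv, NNReal.coe_mul, Real.coe_toNNReal _ hxx.le]
    push_cast
    rfl
  have hv0 : (0 : ℝ) < v := by rw [hv']; positivity
  -- Dividing the weights by the variance `v = ‖x‖² / k` makes the bound independent of `x`, as
  -- conditioning on `x` requires.
  have h := (hG.transpose_mulVec x).measureReal_le_sum_sq (fun i => s / v * μ i) (fun i => by
    rw [abs_of_nonneg (mul_nonneg (by positivity) (hμ i)), ← hv]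
    have : s / v * μ i * v = s * μ i := by field_simp
    rw [this]
    exact hsμ i) (s * τ * k)
  rw [← hv] at h
  refine (measureReal_mono ?_).trans (h.trans_eq ?_)
  · intro ω hω
    rw [Set.mem_ofPred_eq] at hω
    have h1 := mul_le_mul_of_nonneg_left hω.le (show 0 ≤ s / (v : ℝ) by positivity)
    have h2 : s / (v : ℝ) * (τ * (x ⬝ᵥ x)) = s * τ * k := by
      rw [hv']; field_simp
    rw [h2, Finset.mul_sum] at h1
    rw [Set.mem_ofPred_eq]
    simpa only [mul_assoc] using h1
  · congr 1
    rw [← Finset.mul_sum]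
    simp_rw [mul_pow]
    rw [← Finset.mul_sum]
    field_simp

/-- The weights vanish on `V`, so only columns independent of the image vector enter the form, and
that vector may be treated as fixed. -/
theorem IsGaussianSketch.measureReal_weighted_image_le (hG : IsGaussianSketch P G) (hk : 0 < k)
    (V : Finset (Fin d)) (u : ↥V → ℝ) (μ : Fin d → ℝ) (hμ : ∀ i, 0 ≤ μ i)
    (hμV : ∀ i ∈ V, μ i = 0) {s τ : ℝ} (hs : 0 ≤ s) (hsμ : ∀ i, s * μ i ≤ 1 / 4) :
    P.real {ω | τ * (((G ω).submatrix id Subtype.val *ᵥ u) ⬝ᵥ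
          ((G ω).submatrix id Subtype.val *ᵥ u)) <
        ∑ i, μ i * (((G ω)ᵀ *ᵥ ((G ω).submatrix id (Subtype.val : ↥V → Fin d) *ᵥ u)) i) ^ 2} ≤
      Real.exp (-(s * τ * k) + s * ∑ i, μ i + 2 * s ^ 2 * ∑ i, μ i ^ 2) := by
  classical
  have hprob : IsProbabilityMeasure P := hG.indep.isProbabilityMeasure
  have hm : ∀ p : Fin k × Fin d, AEMeasurable (fun ω => G ω p.1 p.2) P :=
    fun p => (hG.hasLaw p.1 p.2).aemeasurable
  let f : Ω → Fin k → ℝ := fun ω => (G ω).submatrix id Subtype.val *ᵥ u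
  let g : Ω → Fin d → Fin k → ℝ := fun ω i a => if i ∈ V then 0 else G ω a i
  have hfg : IndepFun f g P := by
    have h := hG.indep.indepFun_finset₀ (Finset.univ ×ˢ V) (Finset.univ ×ˢ Vᶜ)
      (Finset.disjoint_product.2 (Or.inr disjoint_compl_right)) hm
    let φ : (↥((Finset.univ : Finset (Fin k)) ×ˢ V) → ℝ) → Fin k → ℝ := fun F a =>
      ∑ i : ↥V, F ⟨(a, i.1), by simp⟩ * u i
    let ψ : (↥((Finset.univ : Finset (Fin k)) ×ˢ Vᶜ) → ℝ) → Fin d → Fin k → ℝ := fun F i a =>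
      if hi : i ∈ V then 0 else F ⟨(a, i), by simp [hi]⟩
    have hφ : Measurable φ := by fun_prop
    have hψ : Measurable ψ := by
      refine measurable_pi_lambda _ fun i => measurable_pi_lambda _ fun a => ?_
      by_cases hi : i ∈ V
      · simp [ψ, hi]
      · simp only [ψ, hi, dite_false]
        fun_prop
    have := h.comp hφ hψ
    exact this
  have hf : AEMeasurable f P := by
    refine aemeasurable_pi_lambda _ fun a => ?_
    simp only [f, Matrix.mulVec, dotProduct]
    exact Finset.aemeasurable_fun_sum _ fun i _ => (hm (a, i.1)).mul_const _
  have hg : AEMeasurable g P := by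
    refine aemeasurable_pi_lambda _ fun i => aemeasurable_pi_lambda _ fun a => ?_
    by_cases hi : i ∈ V
    · simp [g, hi]
    · simpa [g, hi] using hm (a, i)
  let S : Set ((Fin k → ℝ) × (Fin d → Fin k → ℝ)) :=
    {q | τ * ∑ a, q.1 a * q.1 a < ∑ i, μ i * (∑ a, q.2 i a * q.1 a) ^ 2}
  have hS : MeasurableSet S := measurableSet_lt (by fun_prop) (by fun_prop)
  have key : ∀ (x : Fin k → ℝ) ω, (x, g ω) ∈ S ↔
      τ * (x ⬝ᵥ x) < ∑ i, μ i * (((G ω)ᵀ *ᵥ x) i) ^ 2 := by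
    intro x ω
    have : ∀ i, μ i * (∑ a, g ω i a * x a) ^ 2 = μ i * (((G ω)ᵀ *ᵥ x) i) ^ 2 := by
      intro i
      by_cases hi : i ∈ V
      · simp [hμV i hi]
      · simp [g, hi, Matrix.mulVec, dotProduct]
    simp only [S, Set.mem_ofPred_eq, this]
    rfl
  have h := hfg.measureReal_mem_le hf hg hS
    (c := Real.exp (-(s * τ * k) + s * ∑ i, μ i + 2 * s ^ 2 * ∑ i, μ i ^ 2)) (fun x => by
      simp only [key]
      exact hG.measureReal_weighted_le hk x μ hμ hs hsμ)
  simp only [key] at h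
  exact h

end Sketch

/-! ### Uniform bounds over the coordinates `V` -/

theorem norm_sq_toEuclideanLin {m n : Type*} [Fintype m] [Fintype n] [DecidableEq n]
    (A : Matrix m n ℝ) (v : EuclideanSpace ℝ n) :
    ‖LinearMap.toContinuousLinearMap (Matrix.toEuclideanLin A) v‖ ^ 2 =
      (A *ᵥ v.ofLp) ⬝ᵥ (A *ᵥ v.ofLp) := by
  rw [EuclideanSpace.real_norm_sq_eq]
  simp [dotProduct, sq, Matrix.toLpLin_apply]

theorem norm_sq_eq_dotProduct {n : Type*} [Fintype n] (v : EuclideanSpace ℝ n) :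
    ‖v‖ ^ 2 = v.ofLp ⬝ᵥ v.ofLp := by
  rw [EuclideanSpace.real_norm_sq_eq]
  simp [dotProduct, sq]

theorem exists_extend_dotProduct {d : ℕ} (V : Finset (Fin d)) (u : ↥V → ℝ) :
    ∃ w : Fin d → ℝ, w ⬝ᵥ w = u ⬝ᵥ u ∧ ∀ {k : ℕ} (H : Matrix (Fin k) (Fin d) ℝ),
      H *ᵥ w = H.submatrix id Subtype.val *ᵥ u := by
  have key : ∀ (c : Fin d → ℝ), ∑ i, c i * (if h : i ∈ V then u ⟨i, h⟩ else 0)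
      = ∑ i : ↥V, c i.1 * u i := by
    intro c
    rw [← Finset.sum_subset (Finset.subset_univ V) (fun i _ hi => by simp [hi]),
      ← Finset.sum_coe_sort]
    exact Finset.sum_congr rfl fun i _ => by simp
  refine ⟨fun i => if h : i ∈ V then u ⟨i, h⟩ else 0, ?_, fun H => ?_⟩
  · rw [dotProduct, key]
    exact Finset.sum_congr rfl fun i _ => by simp
  · ext a
    exact key (H a)

section Sketch

variable {Ω : Type*} [MeasurableSpace Ω] {P : Measure Ω} {k d : ℕ}
  {G : Ω → Matrix (Fin k) (Fin d) ℝ}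

/-- With high probability, the sketch is nearly isometric on the coordinates `V`, and on the image
of these coordinates the weighted form supported off `V` is small. -/
theorem IsGaussianSketch.measureReal_not_isometric_or_not_small_le (hG : IsGaussianSketch P G)
    (hk : 0 < k) (V : Finset (Fin d)) (μ : Fin d → ℝ) (hμ : ∀ i, 0 ≤ μ i)
    (hμV : ∀ i ∈ V, μ i = 0) {s t τ : ℝ} (hs : 0 ≤ s) (hsμ : ∀ i, s * μ i ≤ 1 / 4)
    (ht0 : 0 ≤ t) (ht1 : t ≤ 1 / 8) (hτ : 0 ≤ τ) :
    P.real {ω | ¬ ((∀ v : ↥V → ℝ, (1 - 4 * t) * (v ⬝ᵥ v) ≤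
          ((G ω).submatrix id Subtype.val *ᵥ v) ⬝ᵥ ((G ω).submatrix id Subtype.val *ᵥ v)) ∧
        ∀ v : ↥V → ℝ,
          ∑ i, μ i * (((G ω)ᵀ *ᵥ ((G ω).submatrix id (Subtype.val : ↥V → Fin d) *ᵥ v)) i) ^ 2 ≤
          12 * τ * (((G ω).submatrix id Subtype.val *ᵥ v) ⬝ᵥ
            ((G ω).submatrix id Subtype.val *ᵥ v)))} ≤
      25 ^ V.card * (4 * Real.exp (-(k * t ^ 2 / 8))) +
        5 ^ V.card * Real.exp (-(s * τ * k) + s * ∑ i, μ i + 2 * s ^ 2 * ∑ i, μ i ^ 2) := by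
  classical
  have hprob : IsProbabilityMeasure P := hG.indep.isProbabilityMeasure
  obtain ⟨N, hNcard, hN⟩ := exists_half_net_sphere (EuclideanSpace ℝ ↥V)
  rw [finrank_euclideanSpace, Fintype.card_coe] at hNcard
  let HV : Ω → Matrix (Fin k) ↥V ℝ := fun ω => (G ω).submatrix id Subtype.val
  let bad : (↥V → ℝ) → Set Ω := fun u =>
    {ω | t * (u ⬝ᵥ u) < |(HV ω *ᵥ u) ⬝ᵥ (HV ω *ᵥ u) - u ⬝ᵥ u|}
  let bad' : (↥V → ℝ) → Set Ω := fun u =>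
    {ω | τ * ((HV ω *ᵥ u) ⬝ᵥ (HV ω *ᵥ u)) < ∑ i, μ i * (((G ω)ᵀ *ᵥ (HV ω *ᵥ u)) i) ^ 2}
  have hbad : ∀ u, P.real (bad u) ≤ 2 * Real.exp (-(k * t ^ 2 / 8)) := by
    intro u
    obtain ⟨w, hw1, hw2⟩ := exists_extend_dotProduct V u
    have := hG.measureReal_norm_sq_le hk w ht0 (by linarith : t ≤ 1)
    simpa only [hw1, hw2] using this
  have hbad' : ∀ u, P.real (bad' u) ≤
      Real.exp (-(s * τ * k) + s * ∑ i, μ i + 2 * s ^ 2 * ∑ i, μ i ^ 2) := fun u =>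
    hG.measureReal_weighted_image_le hk V u μ hμ hμV hs hsμ
  -- Near isometry is imposed on sums and differences of net points, to be used by polarisation.
  let U₁ : Set Ω := ⋃ p ∈ N ×ˢ N, (bad (p.1 + p.2).ofLp ∪ bad (p.1 - p.2).ofLp)
  let U₂ : Set Ω := ⋃ y ∈ N, bad' y.ofLp
  have hU₁ : P.real U₁ ≤ 25 ^ V.card * (4 * Real.exp (-(k * t ^ 2 / 8))) := by
    refine (measureReal_biUnion_finset_le _ _).trans ?_
    refine (Finset.sum_le_card_nsmul _ _ (4 * Real.exp (-(k * t ^ 2 / 8))) fun p _ => ?_).trans ?_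
    · refine (measureReal_union_le _ _).trans ?_
      linarith [hbad (p.1 + p.2).ofLp, hbad (p.1 - p.2).ofLp]
    · rw [nsmul_eq_mul, Finset.card_product]
      refine mul_le_mul_of_nonneg_right ?_ (by positivity)
      have : N.card * N.card ≤ 25 ^ V.card :=
        (Nat.mul_le_mul hNcard hNcard).trans_eq (by rw [← mul_pow]; norm_num)
      exact_mod_cast this
  have hU₂ : P.real U₂ ≤ 5 ^ V.card *
      Real.exp (-(s * τ * k) + s * ∑ i, μ i + 2 * s ^ 2 * ∑ i, μ i ^ 2) := by
    refine (measureReal_biUnion_finset_le _ _).trans ?_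
    refine (Finset.sum_le_card_nsmul _ _ _ fun y _ => hbad' y.ofLp).trans ?_
    rw [nsmul_eq_mul]
    refine mul_le_mul_of_nonneg_right ?_ (by positivity)
    exact_mod_cast hNcard
  refine le_trans ((measureReal_mono ?_).trans (measureReal_union_le U₁ U₂)) (add_le_add hU₁ hU₂)
  intro ω hω
  by_contra hcon
  rw [Set.mem_union, not_or] at hcon
  obtain ⟨hc1, hc2⟩ := hcon
  simp only [U₁, U₂, Set.mem_iUnion, not_exists, Finset.mem_product, Set.mem_union, not_or, bad,
    bad', Set.mem_ofPred_eq, not_lt] at hc1 hc2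
  rw [Set.mem_ofPred_eq] at hω
  refine hω ?_
  let S := LinearMap.toContinuousLinearMap (Matrix.toEuclideanLin (HV ω))
  have hS : ∀ v : EuclideanSpace ℝ ↥V, |‖S v‖ ^ 2 - ‖v‖ ^ 2| ≤ 4 * t * ‖v‖ ^ 2 := by
    refine abs_norm_sq_sub_norm_sq_le_of_half_net hN S ht0 fun y hy z hz => ?_
    simp only [S, norm_sq_toEuclideanLin]
    simp only [norm_sq_eq_dotProduct]
    exact hc1 (y, z) ⟨hy, hz⟩
  have hS' : ∀ v : ↥V → ℝ, |(HV ω *ᵥ v) ⬝ᵥ (HV ω *ᵥ v) - v ⬝ᵥ v| ≤ 4 * t * (v ⬝ᵥ v) := by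
    intro v
    have := hS (WithLp.toLp 2 v)
    rwa [norm_sq_toEuclideanLin, norm_sq_eq_dotProduct] at this
  have hiso : ∀ v : ↥V → ℝ, (1 - 4 * t) * (v ⬝ᵥ v) ≤ (HV ω *ᵥ v) ⬝ᵥ (HV ω *ᵥ v) := fun v => by
    linarith [(abs_le.1 (hS' v)).1]
  refine ⟨hiso, fun v => ?_⟩
  let W : Matrix (Fin d) ↥V ℝ := Matrix.diagonal (fun i => √(μ i)) * ((G ω)ᵀ * HV ω)
  have hW : ∀ v : ↥V → ℝ, (W *ᵥ v) ⬝ᵥ (W *ᵥ v) =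
      ∑ i, μ i * (((G ω)ᵀ *ᵥ (HV ω *ᵥ v)) i) ^ 2 := by
    intro v
    simp only [W, ← Matrix.mulVec_mulVec, dotProduct, Matrix.mulVec_diagonal]
    refine Finset.sum_congr rfl fun i _ => ?_
    nth_rewrite 3 [← Real.mul_self_sqrt (hμ i)]
    ring
  let R := LinearMap.toContinuousLinearMap (Matrix.toEuclideanLin W)
  -- On the net the image has squared norm at most `1 + 4t ≤ 3/2`. The net costs a factor 4 on
  -- squares, and `‖v‖² ≤ 2 ‖H_V v‖²` another 2, hence `12 τ`.
  have hR : ‖R‖ ≤ 2 * √(τ * (3 / 2)) := by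
    refine R.opNorm_le_two_mul_of_half_net hN (Real.sqrt_nonneg _) fun y hy hy1 => ?_
    refine Real.le_sqrt_of_sq_le ?_
    have hyy : y.ofLp ⬝ᵥ y.ofLp = 1 := by rw [← norm_sq_eq_dotProduct, hy1, one_pow]
    rw [norm_sq_toEuclideanLin, hW]
    refine (hc2 y hy).trans (mul_le_mul_of_nonneg_left ?_ hτ)
    have := (abs_le.1 (hS' y.ofLp)).2
    rw [hyy] at this
    linarith
  have hRv := R.le_of_opNorm_le hR (WithLp.toLp 2 v)
  have hRv2 : ‖R (WithLp.toLp 2 v)‖ ^ 2 ≤ 6 * τ * ‖WithLp.toLp 2 v‖ ^ 2 := by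
    refine (pow_le_pow_left₀ (norm_nonneg _) hRv 2).trans_eq ?_
    rw [mul_pow, mul_pow, Real.sq_sqrt (by positivity)]
    ring
  rw [norm_sq_toEuclideanLin, norm_sq_eq_dotProduct, hW] at hRv2
  refine hRv2.trans ?_
  have hvv : 0 ≤ v ⬝ᵥ v := by simpa using dotProduct_star_self_nonneg v
  have h2 : v ⬝ᵥ v ≤ 2 * ((HV ω *ᵥ v) ⬝ᵥ (HV ω *ᵥ v)) := by
    have := hiso v
    nlinarith
  calc 6 * τ * (v ⬝ᵥ v) ≤ 6 * τ * (2 * ((HV ω *ᵥ v) ⬝ᵥ (HV ω *ᵥ v))) := by gcongr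
    _ = _ := by ring

end Sketch

/-! ### Numerical estimates and choice of eigenvectors -/

/-- The base `625 = 25²` covers pairs of net points when `|V| ≤ 2ℓ`; the rate 13 beats it because
`1250 e⁻¹³ ≤ 1/160`. -/
theorem union_bound_constant_le {ℓ : ℕ} (hℓ : 1 ≤ ℓ) :
    (625 : ℝ) ^ ℓ * (4 * Real.exp (-(13 * ℓ))) ≤ 1 / 40 * (1 / 2 : ℝ) ^ ℓ := by
  have h13 : (200000 : ℝ) ≤ Real.exp 13 := by
    have h : Real.exp 13 = Real.exp 1 ^ 13 := by rw [← Real.exp_nat_mul]; norm_num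
    rw [h]
    calc (200000 : ℝ) ≤ 2.7 ^ 13 := by norm_num
      _ ≤ _ := by
        gcongr
        linarith [Real.exp_one_gt_d9]
  have hr : 1250 * Real.exp (-13) ≤ 1 / 160 := by
    rw [Real.exp_neg, ← div_eq_mul_inv, div_le_iff₀ (Real.exp_pos _)]
    linarith
  have hpow : (1250 * Real.exp (-13)) ^ ℓ ≤ 1 / 160 :=
    (pow_le_of_le_one (by positivity) (by linarith) (by omega)).trans hr
  have he : Real.exp (-(13 * (ℓ : ℝ))) = Real.exp (-13) ^ ℓ := by
    rw [← Real.exp_nat_mul]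
    congr 1
    ring
  have hsplit : (1250 * Real.exp (-13)) ^ ℓ = 2 ^ ℓ * (625 ^ ℓ * Real.exp (-13) ^ ℓ) := by
    rw [← mul_pow, ← mul_pow]
    congr 1
    ring
  rw [hsplit] at hpow
  rw [he, one_div_pow]
  have h2 : (0 : ℝ) < 2 ^ ℓ := by positivity
  rw [mul_one_div, le_div_iff₀ h2]
  linarith

/-- By AM-GM, `d + 1/ε² ≥ 2√d / ε`, so `ε k ≥ 20000 √d`. The negative term is then at least a large
multiple of `√ℓ √d ≥ ℓ` and dominates the others. -/
theorem chernoff_exponent_le {ℓ d k : ℕ} {ε m m₂ : ℝ} (hℓd : ℓ ≤ d) (hε : 0 < ε)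
    (hk : 10000 * ((d : ℝ) + 1 / ε ^ 2) ≤ k) (hm : m ≤ √d) (hm₂ : m₂ ≤ 1) :
    -(√ℓ / 4 * (ε / 32) * k) + √ℓ / 4 * m + 2 * (√ℓ / 4) ^ 2 * m₂ ≤ -(13 * ℓ) := by
  have hq0 := Real.sqrt_nonneg (ℓ : ℝ)
  have hp0 := Real.sqrt_nonneg (d : ℝ)
  have hqp : √(ℓ : ℝ) ≤ √(d : ℝ) := Real.sqrt_le_sqrt (by exact_mod_cast hℓd)
  have hq : √(ℓ : ℝ) ^ 2 = ℓ := Real.sq_sqrt (by positivity)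
  have hp : √(d : ℝ) ^ 2 = d := Real.sq_sqrt (by positivity)
  set q := √(ℓ : ℝ)
  set p := √(d : ℝ)
  rw [← hq]
  rw [← hp] at hk
  have hkε : 20000 * p ≤ ε * k := by
    have h1 : ε * (10000 * (p ^ 2 + 1 / ε ^ 2)) - 20000 * p = 10000 * (p * ε - 1) ^ 2 / ε := by
      field_simp
      ring
    have h2 : 0 ≤ 10000 * (p * ε - 1) ^ 2 / ε := by positivity
    have h3 := mul_le_mul_of_nonneg_left hk hε.le
    linarith
  have h4 := mul_le_mul_of_nonneg_left hkε hq0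
  have h5 := mul_le_mul_of_nonneg_left hm hq0
  have h6 := mul_le_mul_of_nonneg_left hm₂ (sq_nonneg q)
  have h7 := mul_le_mul_of_nonneg_left hqp hq0
  nlinarith

theorem exists_card_eq_sortedEigenvalue_le {n : ℕ} {A : Matrix (Fin n) (Fin n) ℝ}
    (hA : A.IsHermitian) (ℓ : ℕ) (h1 : 1 ≤ ℓ) (hn : ℓ ≤ n) :
    ∃ T : Finset (Fin n), T.card = ℓ ∧ ∀ i ∈ T, sortedEigenvalue hA ℓ h1 hn ≤ hA.eigenvalues i := by
  obtain ⟨e, he⟩ : ∃ e : Fin (Fintype.card (Fin n)) ≃ Fin n,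
    e = Fintype.equivOfCardEq (Fintype.card_fin _) := ⟨_, rfl⟩
  refine ⟨Finset.univ.map ((Fin.castLEEmb (by simpa using hn)).trans e.toEmbedding : Fin ℓ ↪ Fin n),
    by simp, fun i hi => ?_⟩
  obtain ⟨j, -, rfl⟩ := Finset.mem_map.1 hi
  refine le_trans ?_ (sortedEigenvalue_eq_eigenvalues hA e he _).ge
  refine hA.eigenvalues₀_antitone ?_
  have := j.2
  simp only [Fin.le_def, Fin.coe_castLEEmb, Fin.val_castLE]
  omega

theorem Matrix.IsHermitian.exists_orthogonal_diagonal {n : ℕ} {A : Matrix (Fin n) (Fin n) ℝ}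
    (hA : A.IsHermitian) :
    ∃ U : Matrix (Fin n) (Fin n) ℝ, Uᵀ * U = 1 ∧ A = U * Matrix.diagonal hA.eigenvalues * Uᵀ := by
  refine ⟨hA.eigenvectorUnitary, ?_, ?_⟩
  · rw [← Matrix.conjTranspose_eq_transpose_of_trivial, ← Matrix.star_eq_conjTranspose]
    exact Unitary.coe_star_mul_self _
  · conv_lhs => rw [hA.spectral_theorem]
    rw [Unitary.conjStarAlgAut_apply, Matrix.star_eq_conjTranspose,
      Matrix.conjTranspose_eq_transpose_of_trivial]
    rfl

/-! ### Assembly of the theorem -/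

theorem mainTheorem3 :
    ∃ C : ℝ, 0 < C ∧
      ∀ (d k ℓ : ℕ) (ε : ℝ) (D : Matrix (Fin d) (Fin d) ℝ) (hD : D.IsHermitian)
        (hℓ : 1 ≤ ℓ) (hℓd : ℓ ≤ d),
        0 < ε → ‖D‖ ≤ 1 → 0 ≤ sortedEigenvalue hD ℓ hℓ hℓd →
        C * ((d : ℝ) + 1 / ε ^ 2) ≤ (k : ℝ) →
        ∃ hℓk : ℓ ≤ k,
          ∀ (Ω : Type*) [MeasurableSpace Ω] (P : Measure Ω) [IsProbabilityMeasure P]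
            (G : Ω → Matrix (Fin k) (Fin d) ℝ), IsGaussianSketch P G →
            P.real {ω | ¬ (sortedEigenvalue hD ℓ hℓ hℓd - ε ≤
                sortedEigenvalue (isHermitian_sketch (G ω) hD) ℓ hℓ hℓk)} ≤
              1 / 20 * (1 / 2 : ℝ) ^ ℓ := by
  classical
  refine ⟨10000, by norm_num, fun d k ℓ ε D hD hℓ hℓd hε hDn hlam hk => ?_⟩
  have hℓ0 : (0 : ℝ) < ℓ := by exact_mod_cast hℓ
  have hℓd' : (ℓ : ℝ) ≤ d := by exact_mod_cast hℓd
  have hε2 : 0 < 1 / ε ^ 2 := by positivity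
  have hkℓ : 10000 * (ℓ : ℝ) ≤ k := by linarith
  have hkε : 10000 * (1 / ε ^ 2) ≤ k := by linarith
  have hk0 : (0 : ℝ) < k := by linarith
  have hℓk : ℓ ≤ k := by
    have : (ℓ : ℝ) ≤ k := by linarith
    exact_mod_cast this
  refine ⟨hℓk, fun Ω _ P _ G hG => ?_⟩
  set lam := sortedEigenvalue hD ℓ hℓ hℓd with hlam_def
  set Λ := hD.eigenvalues with hΛ_def
  obtain ⟨U, hU, hDU⟩ := hD.exists_orthogonal_diagonal
  obtain ⟨T, hT, hTΛ⟩ := exists_card_eq_sortedEigenvalue_le hD ℓ hℓ hℓd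
  have hΛ2 : ∑ i, Λ i ^ 2 ≤ 1 := by
    rw [hΛ_def, hD.sum_sq_eigenvalues_eq_frobenius_norm_sq]
    exact pow_le_one₀ (norm_nonneg _) hDn
  have hsub : ∀ s : Finset (Fin d), ∑ i ∈ s, Λ i ^ 2 ≤ 1 := fun s =>
    (Finset.sum_le_univ_sum_of_nonneg fun i => sq_nonneg _).trans hΛ2
  have hlam2 : ℓ * lam ^ 2 ≤ 1 := by
    refine le_trans ?_ (hsub T)
    rw [← hT, ← nsmul_eq_mul]
    exact Finset.card_nsmul_le_sum _ _ _ fun i hi => pow_le_pow_left₀ hlam (hTΛ i hi) 2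
  -- The threshold `1/ℓ` on squares balances two needs: at most `ℓ` indices exceed it, and the
  -- remaining negative parts are at most `1/√ℓ`.
  let B : Finset (Fin d) := Finset.univ.filter fun i => i ∉ T ∧ Λ i < 0 ∧ 1 < ℓ * Λ i ^ 2
  have hB : B.card ≤ ℓ := by
    have h1 : (B.card : ℝ) ≤ ∑ i ∈ B, ℓ * Λ i ^ 2 := by
      rw [← nsmul_one]
      exact Finset.card_nsmul_le_sum _ _ _ fun i hi => (Finset.mem_filter.1 hi).2.2.2.le
    rw [← Finset.mul_sum] at h1
    have h2 := mul_le_mul_of_nonneg_left (hsub B) hℓ0.le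
    have h3 : (B.card : ℝ) ≤ ℓ := by linarith
    exact_mod_cast h3
  have hTB : Disjoint T B := Finset.disjoint_left.2 fun i hi hiB => (Finset.mem_filter.1 hiB).2.1 hi
  have hV : (T ∪ B).card ≤ 2 * ℓ := by
    rw [Finset.card_union_of_disjoint hTB]
    omega
  let μ : Fin d → ℝ := fun i => if i ∈ T ∪ B then 0 else max (-Λ i) 0
  have hμ : ∀ i, 0 ≤ μ i := fun i => by
    simp only [μ]
    split_ifs
    exacts [le_rfl, le_max_right _ _]
  have hμV : ∀ i ∈ T ∪ B, μ i = 0 := fun i hi => if_pos hi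
  have hμΛ : ∀ i, i ∉ T → i ∉ B → -μ i ≤ Λ i := fun i hiT hiB => by
    have : μ i = max (-Λ i) 0 := if_neg (by simp [hiT, hiB])
    linarith [le_max_left (-Λ i) 0]
  have hμ2 : ∀ i, μ i ^ 2 ≤ Λ i ^ 2 := fun i => by
    simp only [μ]
    split_ifs
    · simpa using sq_nonneg (Λ i)
    · rcases max_choice (-Λ i) 0 with h | h <;> rw [h]
      · rw [neg_sq]
      · simpa using sq_nonneg (Λ i)
  have hμℓ : ∀ i, ℓ * μ i ^ 2 ≤ 1 := fun i => by
    by_cases hi : i ∈ T ∪ B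
    · rw [hμV i hi]; simp
    · rcases lt_or_ge (Λ i) 0 with h0 | h0
      · have : ℓ * Λ i ^ 2 ≤ 1 := by
          by_contra hcon
          rw [Finset.mem_union, not_or] at hi
          exact hi.2 (Finset.mem_filter.2 ⟨Finset.mem_univ _, hi.1, h0, not_le.1 hcon⟩)
        exact (mul_le_mul_of_nonneg_left (hμ2 i) hℓ0.le).trans this
      · have : μ i = 0 := by
          simp only [μ, if_neg hi]
          exact max_eq_right (by linarith)
        rw [this]; simp
  -- The bound `μ i ≤ 1/√ℓ` is what allows the Chernoff parameter `√ℓ / 4`.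
  have hsμ : ∀ i, √ℓ / 4 * μ i ≤ 1 / 4 := fun i => by
    have : √ℓ * μ i ≤ 1 := by
      refine le_of_sq_le_sq ?_ zero_le_one
      rw [mul_pow, Real.sq_sqrt hℓ0.le, one_pow]
      exact hμℓ i
    linarith
  have hμsum2 : ∑ i, μ i ^ 2 ≤ 1 := (Finset.sum_le_sum fun i _ => hμ2 i).trans hΛ2
  have hμsum : ∑ i, μ i ≤ √d := by
    refine Real.le_sqrt_of_sq_le ((sq_sum_le_card_mul_sum_sq (s := Finset.univ)).trans ?_)
    rw [Finset.card_univ, Fintype.card_fin]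
    exact mul_le_of_le_one_right (by positivity) hμsum2
  -- Chosen so that `k t² / 8 = 13 ℓ`.
  set t : ℝ := √(104 * ℓ / k) with ht_def
  have ht2 : t ^ 2 = 104 * ℓ / k := Real.sq_sqrt (by positivity)
  have ht0 : 0 ≤ t := Real.sqrt_nonneg _
  have ht1 : t ≤ 1 / 8 := by
    refine le_of_sq_le_sq ?_ (by norm_num)
    rw [ht2, div_le_iff₀ hk0]
    linarith
  -- Here `λ ≤ 1/√ℓ` cancels the `√ℓ` in `t`.
  have hlamt : lam * t ≤ 11 / 100 * ε := by
    refine le_of_sq_le_sq ?_ (by positivity)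
    rw [mul_pow, ht2]
    have h1 : lam ^ 2 * (104 * ℓ / k) = 104 * (ℓ * lam ^ 2) / k := by ring
    rw [h1, div_le_iff₀ hk0]
    have h2 : 10000 ≤ ε ^ 2 * k := by
      have := mul_le_mul_of_nonneg_left hkε (sq_nonneg ε)
      have e : ε ^ 2 * (10000 * (1 / ε ^ 2)) = 10000 := by field_simp
      linarith
    linarith
  have hH := hG.mul_orthogonal hU
  have hprob := hH.measureReal_not_isometric_or_not_small_le (by exact_mod_cast hk0) (T ∪ B) μ hμ
    hμV (s := √ℓ / 4) (t := t) (τ := ε / 32) (by positivity) hsμ ht0 ht1 (by positivity)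
  have hexp1 : -(k * t ^ 2 / 8) = -(13 * (ℓ : ℝ)) := by
    rw [ht2]; field_simp; norm_num
  have hexp2 := chernoff_exponent_le hℓd hε hk hμsum hμsum2
  have hc := union_bound_constant_le hℓ
  have h25 : (25 : ℝ) ^ (T ∪ B).card ≤ 625 ^ ℓ := by
    refine (pow_le_pow_right₀ (by norm_num) hV).trans_eq ?_
    rw [pow_mul]; norm_num
  have h5 : (5 : ℝ) ^ (T ∪ B).card ≤ 625 ^ ℓ :=
    (pow_le_pow_left₀ (by norm_num) (by norm_num) _).trans h25
  have htotal : 25 ^ (T ∪ B).card * (4 * Real.exp (-(k * t ^ 2 / 8))) + 5 ^ (T ∪ B).card *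
      Real.exp (-(√ℓ / 4 * (ε / 32) * k) + √ℓ / 4 * ∑ i, μ i + 2 * (√ℓ / 4) ^ 2 * ∑ i, μ i ^ 2) ≤
      1 / 20 * (1 / 2 : ℝ) ^ ℓ := by
    rw [hexp1]
    have h1 := mul_le_mul_of_nonneg_right h25 (show 0 ≤ 4 * Real.exp (-(13 * (ℓ : ℝ))) by positivity)
    have h2 := mul_le_mul h5 (Real.exp_le_exp.2 hexp2) (Real.exp_pos _).le (by positivity)
    have h3 : (0 : ℝ) ≤ 625 ^ ℓ * Real.exp (-(13 * ℓ)) := by positivity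
    linarith
  refine ((measureReal_mono ?_).trans hprob).trans htotal
  intro ω hω
  rw [Set.mem_ofPred_eq] at hω ⊢
  refine fun hgood => hω ?_
  have hM : G ω * D * (G ω)ᵀ = (G ω * U) * Matrix.diagonal Λ * (G ω * U)ᵀ := by
    conv_lhs => rw [hDU]
    rw [Matrix.transpose_mul]
    simp only [Matrix.mul_assoc]
    rfl
  refine le_trans ?_ (le_sortedEigenvalue_of_sketch (isHermitian_sketch (G ω) hD) (G ω * U) Λ hM ℓ
    hℓ hℓk T B hTB hT hlam hTΛ μ hμ hμΛ (by linarith) hgood.1 hgood.2)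
  -- The total loss is `4 λ t + 12 ε / 32 ≤ 0.44 ε + 0.375 ε < ε`.
  linarith
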